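/- Identify $\mathbb R^2$ with $\mathbb C$. Let $\mu$ be a real signed Borel measure on $\mathbb C$ of locally finite variation whose set of atoms $\Lambda$ has no finite accumulation point; the intensity at $\lambda$ is $\alpha_\lambda=\mu(\{\lambda\})/2\pi$. Let $\Psi\in L_{1,\mathrm{loc}}(\mathbb C)$ be a real scalar potential of $\mu$, i.e. $\Delta\Psi=\mu$ in the sense of distributions. For an open set $U\subseteq\mathbb C$ with null complement and a real function $\Phi$, let $\mathcal P_-(\Phi,U)$ and $\mathcal P_+(\Phi,U)$ be the operators in $L_2(\mathbb R^2)$ associated with the quadratic forms $$\mathfrak p_-[\psi]=4\int|\partial(e^{\Phi}\psi)|^2e^{-2\Phi}\,dx,\qquad \mathfrak p_+[\psi]=4\int|\bar\partial(e^{-\Phi}\psi)|^2e^{2\Phi}\,dx,$$ where $\partial=\frac12(\partial_1-i\partial_2)$ and $\bar\partial=\frac12(\partial_1+i\partial_2)$ are taken in the sense of distributions on $U$, and the domain of each form consists of all $\psi\in L_2(\mathbb R^2)$ for which the derivative is a (locally integrable) function on $U$ and the form is finite. The maximal Pauli operators are $\mathcal P_{\pm,\max}=\mathcal P_\pm(\Psi,\mathbb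 C\setminus\Lambda)$. The operators $\mathcal P_{\pm,EV}$ are $W^{-1}\mathcal P_\pm(\Psi^*,\mathbb C)W$, where $m_\lambda\in\mathbb Z$ is determined by $\alpha_\lambda+m_\lambda\in[-\frac12,\frac12)$, $F$ and $G$ are entire functions whose zeros are exactly the points $\lambda$ with $m_\lambda>0$, of order $m_\lambda$, respectively the points with $m_\lambda<0$, of order $-m_\lambda$, $\Psi^*=\Psi+\log|F|-\log|G|$, and $W$ is multiplication by $\overline L/|L|$ with $L=F\overline G$ (one may take $F=G=1$ if all $\alpha_\lambda\in[-\frac12,\frac12)$). Suppose that for every $R>0$ there is a disc of radius $R$ on which $\mu$ vanishes, i.e. which is null for the variation $|\mu|$. Then, for each of the operators $\mathcal P_{-,\max}$, $\mathcal P_{+,\max}$, $\mathcal P_{-,EV}$, $\mathcal P_{+,EV}$ (for every admissible choice of $\Psi$, $F$, $G$), zero belongs to the spectrum and is not an isolated point of it: every neighbourhood of zero contains nonzero points of the spectrum. -/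

import Mathlib

open MeasureTheory Filter Topology
open scoped ContDiff ComplexConjugate

noncomputable section

namespace Pauli

/-- The Hilbert space `L₂(ℝ²)`, with `ℝ²` identified with `ℂ`. -/
abbrev H : Type := Lp ℂ 2 (volume : Measure ℂ)

/-- A magnetic field: a Borel signed measure `μ = pos - neg` of locally finite variation, given by
its Jordan decomposition, such that the set of its atoms has no finite accumulation point. -/
structure MagneticField where
  pos : Measure ℂ
  neg : Measure ℂ
  locallyFinite_pos : IsLocallyFiniteMeasure pos
  locallyFinite_neg : IsLocallyFiniteMeasure neg
  mutuallySingular : Measure.MutuallySingular pos neg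
  noAccPt_atoms : ∀ z : ℂ, ¬ AccPt z (𝓟 {w : ℂ | pos {w} ≠ 0 ∨ neg {w} ≠ 0})

namespace MagneticField

/-- The support of the discrete part of the field. -/
def atoms (μ : MagneticField) : Set ℂ := {w : ℂ | μ.pos {w} ≠ 0 ∨ μ.neg {w} ≠ 0}

/-- The field vanishes on `s`: its total variation gives `s` measure zero. -/
def VanishesOn (μ : MagneticField) (s : Set ℂ) : Prop := μ.pos s = 0 ∧ μ.neg s = 0

/-- The intensity `α` of the solenoid at `z`: the atom of `μ` at `z` has mass `2πα`. -/
def intensity (μ : MagneticField) (z : ℂ) : ℝ :=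
  ((μ.pos {z}).toReal - (μ.neg {z}).toReal) / (2 * Real.pi)

/-- The unique integer `m` such that `α + m` lies in `[-1/2, 1/2)`, `α` the intensity at `z`. -/
def reducingInt (μ : MagneticField) (z : ℂ) : ℤ := -⌊μ.intensity z + 1 / 2⌋

/-- `Ψ` is a scalar potential of `μ`: a locally integrable function with `ΔΨ = μ` in the sense
of distributions on the plane. -/
def IsPotential (μ : MagneticField) (Ψ : ℂ → ℝ) : Prop :=
  LocallyIntegrable Ψ volume ∧
    ∀ φ : ℂ → ℝ, ContDiff ℝ ∞ φ → HasCompactSupport φ →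
      ∫ z, Ψ z * Laplacian.laplacian φ z = ∫ z, φ z ∂μ.pos - ∫ z, φ z ∂μ.neg

end MagneticField

/-- The derivative `∂ = (∂₁ - i∂₂)/2`. -/
def del (φ : ℂ → ℂ) (z : ℂ) : ℂ := (fderiv ℝ φ z 1 - Complex.I * fderiv ℝ φ z Complex.I) / 2

/-- The derivative `∂̄ = (∂₁ + i∂₂)/2`. -/
def delBar (φ : ℂ → ℂ) (z : ℂ) : ℂ := (fderiv ℝ φ z 1 + Complex.I * fderiv ℝ φ z Complex.I) / 2

/-- For `d` equal to `del` or `delBar`: the derivative `d f`, taken in the sense of distributions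
on the open set `U`, is the function `g`. -/
def HasWeakDeriv (d : (ℂ → ℂ) → ℂ → ℂ) (U : Set ℂ) (f g : ℂ → ℂ) : Prop :=
  LocallyIntegrableOn f U volume ∧ LocallyIntegrableOn g U volume ∧
    ∀ φ : ℂ → ℂ, ContDiff ℝ ∞ φ → HasCompactSupport φ → tsupport φ ⊆ U →
      ∫ z, f z * d φ z = - ∫ z, g z * φ z

/-- A weak derivative is determined almost everywhere on `U`. -/
theorem HasWeakDeriv.ae_eq {d : (ℂ → ℂ) → ℂ → ℂ} {U : Set ℂ} (hU : IsOpen U) {f g₁ g₂ : ℂ → ℂ}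
    (h₁ : HasWeakDeriv d U f g₁) (h₂ : HasWeakDeriv d U f g₂) :
    ∀ᵐ z ∂(volume : Measure ℂ), z ∈ U → g₁ z = g₂ z := by
  have key := hU.ae_eq_zero_of_integral_contDiff_smul_eq_zero (h₁.2.1.sub h₂.2.1) ?_
  · filter_upwards [key] with z hz hzU
    exact sub_eq_zero.mp (hz hzU)
  · intro φ hφ hc hs
    have hcont : Continuous (fun z => (φ z : ℂ)) := Complex.continuous_ofReal.comp hφ.continuous
    have hts : tsupport (fun z => (φ z : ℂ)) = tsupport φ := by
      simp [tsupport, Function.support]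
    have hc' : HasCompactSupport (fun z => (φ z : ℂ)) := by
      unfold HasCompactSupport
      rw [hts]
      exact hc
    have hsm : ContDiff ℝ ∞ (fun z => (φ z : ℂ)) := Complex.ofRealCLM.contDiff.comp hφ
    have int : ∀ g : ℂ → ℂ, LocallyIntegrableOn g U volume →
        Integrable (fun z => g z * (φ z : ℂ)) volume := by
      intro g hg
      have hK : IntegrableOn g (tsupport φ) volume := hg.integrableOn_compact_subset hs hc
      have h := hK.mul_continuousOn hcont.continuousOn hc
      refine (integrableOn_iff_integrable_of_support_subset ?_).mp h
      intro z hz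
      apply subset_tsupport φ
      intro h0
      apply hz
      simp [h0]
    have e₁ := h₁.2.2 _ hsm hc' (hts ▸ hs)
    have e₂ := h₂.2.2 _ hsm hc' (hts ▸ hs)
    have e : ∫ z, g₁ z * (φ z : ℂ) = ∫ z, g₂ z * (φ z : ℂ) := neg_injective (e₁.symm.trans e₂)
    calc ∫ z, φ z • (g₁ - g₂) z = ∫ z, (g₁ z * (φ z : ℂ) - g₂ z * (φ z : ℂ)) := by
          congr 1
          ext z
          simp only [Pi.sub_apply, Complex.real_smul]
          ring
      _ = 0 := by rw [integral_sub (int _ h₁.2.1) (int _ h₂.2.1), e, sub_self]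

open Classical in
/-- The weak derivative of `f` on `U`, if it is a function. -/
def weakDeriv (d : (ℂ → ℂ) → ℂ → ℂ) (U : Set ℂ) (f : ℂ → ℂ) : ℂ → ℂ :=
  if h : ∃ g, HasWeakDeriv d U f g then h.choose else 0

/-- The function `e^Θ ψ`. -/
def weighted (Θ : ℂ → ℝ) (ψ : H) (z : ℂ) : ℂ := (Real.exp (Θ z) : ℂ) * ψ z

/-- The domain of the quadratic form `4 ∫ |d (e^Θ ψ)|² e^{-2Θ} dx`: all `ψ ∈ L₂` for which the
derivative, in the sense of distributions on `U`, is a function and the form is finite. -/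
def formDomain (d : (ℂ → ℂ) → ℂ → ℂ) (U : Set ℂ) (Θ : ℂ → ℝ) : Set H :=
  {ψ : H | (∃ g, HasWeakDeriv d U (weighted Θ ψ) g) ∧
    ∫⁻ z in U, ENNReal.ofReal
      (‖weakDeriv d U (weighted Θ ψ) z‖ ^ 2 * Real.exp (-2 * Θ z)) < ⊤}

/-- The sesquilinear form of `4 ∫ |d (e^Θ ψ)|² e^{-2Θ} dx`, conjugate-linear in `φ`. -/
def form (d : (ℂ → ℂ) → ℂ → ℂ) (U : Set ℂ) (Θ : ℂ → ℝ) (φ ψ : H) : ℂ :=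
  4 * ∫ z in U, conj (weakDeriv d U (weighted Θ φ) z) * weakDeriv d U (weighted Θ ψ) z *
    (Real.exp (-2 * Θ z) : ℂ)

/-- The graph of the operator associated with a sesquilinear form `a` on the domain `D`:
`T ψ = h` when `ψ ∈ D` and `a(φ, ψ) = ⟨φ, h⟩` for all `φ ∈ D`. -/
def formOperator (D : Set H) (a : H → H → ℂ) : Set (H × H) :=
  {p : H × H | p.1 ∈ D ∧ ∀ φ ∈ D, a φ p.1 = inner ℂ φ p.2}

/-- The spectrum of the operator `T` with graph `G`: `lam` is outside it when `T - lam` has an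
everywhere defined bounded inverse. -/
def spec (G : Set (H × H)) : Set ℂ :=
  {lam : ℂ | ¬ ∃ R : H →L[ℂ] H, ∀ f ψ : H, (ψ, f + lam • ψ) ∈ G ↔ ψ = R f}

/-- The spin-down operator with potential `Ψ`, of the form `4 ∫ |∂ (e^Ψ ψ)|² e^{-2Ψ} dx` with the
derivative in the sense of distributions on `U`. -/
def minusOperator (U : Set ℂ) (Ψ : ℂ → ℝ) : Set (H × H) :=
  formOperator (formDomain del U Ψ) (form del U Ψ)

/-- The spin-up operator with potential `Ψ`, of the form `4 ∫ |∂̄ (e^{-Ψ} ψ)|² e^{2Ψ} dx` with the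
derivative in the sense of distributions on `U`. -/
def plusOperator (U : Set ℂ) (Ψ : ℂ → ℝ) : Set (H × H) :=
  formOperator (formDomain delBar U (fun z => -Ψ z)) (form delBar U (fun z => -Ψ z))

/-- The maximal operator `P_{-,max}`: derivatives on the complement of the solenoids. -/
def minusMax (μ : MagneticField) (Ψ : ℂ → ℝ) : Set (H × H) := minusOperator μ.atomsᶜ Ψ

/-- The maximal operator `P_{+,max}`. -/
def plusMax (μ : MagneticField) (Ψ : ℂ → ℝ) : Set (H × H) := plusOperator μ.atomsᶜ Ψ

/-- Gauge data reducing all intensities of `μ` to `[-1/2, 1/2)`: with `m` the reducing integers,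
entire functions `F` and `G` whose zeros are the points with `m > 0`, of order `m`, and the points
with `m < 0`, of order `-m`, respectively. If all intensities already lie in `[-1/2, 1/2)`,
`F = G = 1` is a choice. -/
structure IsGauge (μ : MagneticField) (F G : ℂ → ℂ) : Prop where
  entire_F : Differentiable ℂ F
  entire_G : Differentiable ℂ G
  order_F : ∀ z, analyticOrderAt F z = ((μ.reducingInt z).toNat : ℕ∞)
  order_G : ∀ z, analyticOrderAt G z = ((-μ.reducingInt z).toNat : ℕ∞)

/-- The potential `Ψ + log |F| - log |G|` of the field with reduced intensities. -/
def reducedPotential (Ψ : ℂ → ℝ) (F G : ℂ → ℂ) (z : ℂ) : ℝ :=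
  Ψ z + Real.log ‖F z‖ - Real.log ‖G z‖

/-- The unimodular function `conj L / |L|`, `L = F · conj G`. Near a solenoid with reducing
integer `m` it is `exp (-i m arg (z - z₀))` times a smooth function. -/
def gaugeFactor (F G : ℂ → ℂ) (z : ℂ) : ℂ :=
  conj (F z * conj (G z)) / (‖F z * conj (G z)‖ : ℂ)

/-- The operator `W⁻¹ T W`, where `T` has graph `S` and `W` is a unimodular function. -/
def gaugeConj (W : ℂ → ℂ) (S : Set (H × H)) : Set (H × H) :=
  {p : H × H | ∃ q ∈ S, (∀ᵐ z ∂(volume : Measure ℂ), q.1 z = W z * p.1 z) ∧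
    (∀ᵐ z ∂(volume : Measure ℂ), q.2 z = W z * p.2 z)}

/-- The operator `P_{-,EV}`: gauge equivalent to the operator of the field with reduced
intensities, whose form uses derivatives in the sense of distributions on the whole plane. -/
def minusEV (Ψ : ℂ → ℝ) (F G : ℂ → ℂ) : Set (H × H) :=
  gaugeConj (gaugeFactor F G) (minusOperator Set.univ (reducedPotential Ψ F G))

/-- The operator `P_{+,EV}`. -/
def plusEV (Ψ : ℂ → ℝ) (F G : ℂ → ℂ) : Set (H × H) :=
  gaugeConj (gaugeFactor F G) (plusOperator Set.univ (reducedPotential Ψ F G))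

/-- Zero lies in the spectrum of the operator and is not an isolated point of it. -/
def ZeroNotIsolated (S : Set (H × H)) : Prop :=
  (0 : ℂ) ∈ spec S ∧ ∀ ε > 0, ∃ lam ∈ spec S, lam ≠ 0 ∧ ‖lam‖ < ε

end Pauli

end

/-! The argument is local. On a disc where the field vanishes, Weyl's lemma
(`exists_harmonic_ae_eq`) makes the potential almost everywhere equal to a harmonic function, hence
to `Re k` with `k` holomorphic for the spin-up form and antiholomorphic for the spin-down form
(`exists_wirtinger_primitive`). For `ψ = e^{i Im k} χ` with `χ` smooth and compactly supported in
the disc, `e^Θ ψ = e^k χ`, the derivative passes through `e^k`, and the weight cancels: the operator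
acts on `ψ` as the free Laplacian `-Δ = -4∂∂̄` acts on `χ` (`mem_formOperator_of_localGauge`).
Neither self-adjointness nor the behaviour of the form domain at the solenoids is needed.

Since the field-free discs are arbitrarily large, plane waves of frequency `κ` cut off at scale `R`
give approximate eigenvectors for `κ²` with relative error `O(1/R)` (`exists_approx_eigenpair`).
Every `κ²` therefore lies in the spectrum (`mem_spec_of_approx`); in particular zero does, and it is
not isolated.

For the EV operators, `log |F|` and `log |G|` are harmonic off the atoms, so the reduced potential
is harmonic on the same discs. The gauge factor has modulus one there, so the approximate
eigenvectors survive the conjugation (`exists_approx_gaugeConj`). -/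

noncomputable section

/-! ### Weyl's lemma: mollification and the mean value property -/

namespace Pauli
open InnerProductSpace Metric ContinuousLinearMap
open scoped Convolution

/-- The Laplacian on the plane as an iterated directional derivative. -/
theorem laplacian_eq_fderiv_fderiv {f : ℂ → ℝ} {z : ℂ} (hf : ContDiffAt ℝ 2 f z) :
    Laplacian.laplacian f z = fderiv ℝ (fun w => fderiv ℝ f w 1) z 1 +
      fderiv ℝ (fun w => fderiv ℝ f w Complex.I) z Complex.I := by
  have h : DifferentiableAt ℝ (fderiv ℝ f) z :=
    (hf.fderiv_right (m := 1) (by norm_num)).differentiableAt (by norm_num)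
  rw [laplacian_eq_iteratedFDeriv_complexPlane]
  simp only [iteratedFDeriv_two_apply]
  rw [fderiv_clm_apply h (by fun_prop), fderiv_clm_apply h (by fun_prop)]
  simp

/-- Directional derivatives of a convolution fall on the smooth factor. -/
theorem fderiv_convolution_right_apply {g ρ : ℂ → ℝ} (hg : LocallyIntegrable g volume)
    (hρ : ContDiff ℝ ∞ ρ) (hc : HasCompactSupport ρ) (x v : ℂ) :
    fderiv ℝ (g ⋆[lsmul ℝ ℝ, volume] ρ) x v =
      (g ⋆[lsmul ℝ ℝ, volume] fun z => fderiv ℝ ρ z v) x := by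
  rw [(hc.hasFDerivAt_convolution_right (lsmul ℝ ℝ) hg (hρ.of_le (by simp)) x).fderiv,
    convolution_precompR_apply (lsmul ℝ ℝ) hg (hc.fderiv ℝ)
      (hρ.continuous_fderiv (by simp))]

theorem contDiff_fderiv_apply_const {ρ : ℂ → ℝ} (hρ : ContDiff ℝ ∞ ρ) (v : ℂ) :
    ContDiff ℝ ∞ fun z => fderiv ℝ ρ z v :=
  (hρ.fderiv_right (m := ∞) (by simp)).clm_apply contDiff_const

/-- Both derivatives fall on `ρ`, so the right side tests `g` against a Laplacian. With
`laplacian_comp_const_sub` it becomes the distributional pairing with `w ↦ ρ (x - w)`. -/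
theorem laplacian_convolution_right {g ρ : ℂ → ℝ} (hg : LocallyIntegrable g volume)
    (hρ : ContDiff ℝ ∞ ρ) (hc : HasCompactSupport ρ) (x : ℂ) :
    Laplacian.laplacian (g ⋆[lsmul ℝ ℝ, volume] ρ) x =
      ∫ t, g t * Laplacian.laplacian ρ (x - t) := by
  have hs : ContDiff ℝ ∞ (g ⋆[lsmul ℝ ℝ, volume] ρ) :=
    hc.contDiff_convolution_right (lsmul ℝ ℝ) hg hρ
  have h2 : ∀ v, fderiv ℝ (fun w => fderiv ℝ (g ⋆[lsmul ℝ ℝ, volume] ρ) w v) x v =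
      ∫ t, g t * fderiv ℝ (fun w => fderiv ℝ ρ w v) (x - t) v := by
    intro v
    simp_rw [fderiv_convolution_right_apply hg hρ hc]
    exact fderiv_convolution_right_apply hg (contDiff_fderiv_apply_const hρ v)
      (hc.fderiv_apply ℝ v) x v
  have hi : ∀ v, Integrable (fun t => g t * fderiv ℝ (fun w => fderiv ℝ ρ w v) (x - t) v) := by
    intro v
    exact (((hc.fderiv_apply ℝ v).fderiv_apply ℝ v).convolutionExists_right (lsmul ℝ ℝ) hg
      (contDiff_fderiv_apply_const (contDiff_fderiv_apply_const hρ v) v).continuous) x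
  rw [laplacian_eq_fderiv_fderiv (hs.contDiffAt.of_le (by norm_cast)), h2, h2,
    ← integral_add (hi 1) (hi Complex.I)]
  congr 1
  ext t
  rw [laplacian_eq_fderiv_fderiv (hρ.contDiffAt.of_le (by norm_cast)), mul_add]

theorem laplacian_comp_const_sub {ρ : ℂ → ℝ} (hρ : ContDiff ℝ ∞ ρ) (x t : ℂ) :
    Laplacian.laplacian (fun w => ρ (x - w)) t = Laplacian.laplacian ρ (x - t) := by
  have h2 : ContDiff ℝ ∞ fun w => ρ (x - w) := hρ.comp (contDiff_const.sub contDiff_id)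
  have key : ∀ {σ : ℂ → ℝ}, ContDiff ℝ ∞ σ → ∀ w v,
      fderiv ℝ (fun w => σ (x - w)) w v = - fderiv ℝ σ (x - w) v := by
    intro σ hσ w v
    have h := ((hσ.differentiable (by simp)) (x - w)).hasFDerivAt.comp w
      ((hasFDerivAt_id w).const_sub x)
    rw [show (fun w => σ (x - w)) = σ ∘ HSub.hSub x from rfl, h.fderiv]
    simp
  rw [laplacian_eq_fderiv_fderiv (h2.contDiffAt.of_le (by norm_cast)),
    laplacian_eq_fderiv_fderiv (hρ.contDiffAt.of_le (by norm_cast))]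
  simp_rw [key hρ, fderiv_fun_neg, neg_apply]
  rw [key (contDiff_fderiv_apply_const hρ 1), key (contDiff_fderiv_apply_const hρ Complex.I)]
  simp

/-- Mollifying a weakly harmonic function yields a harmonic function on a smaller disc. -/
theorem harmonicOnNhd_convolution {g ρ : ℂ → ℝ} {z₀ : ℂ} {R δ : ℝ}
    (hg : LocallyIntegrable g volume)
    (hΔ : ∀ φ : ℂ → ℝ, ContDiff ℝ ∞ φ → HasCompactSupport φ → tsupport φ ⊆ ball z₀ R →
      ∫ z, g z * Laplacian.laplacian φ z = 0)
    (hρ : ContDiff ℝ ∞ ρ) (hsupp : Function.support ρ ⊆ closedBall 0 δ) :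
    HarmonicOnNhd (ρ ⋆[lsmul ℝ ℝ, volume] g) (ball z₀ (R - δ)) := by
  have hc : HasCompactSupport ρ := HasCompactSupport.intro (isCompact_closedBall 0 δ)
    fun x hx => by_contra fun h => hx (hsupp h)
  have hflip : ρ ⋆[lsmul ℝ ℝ, volume] g = g ⋆[lsmul ℝ ℝ, volume] ρ := by
    rw [← convolution_flip]
    congr 1
    ext
    simp
  rw [hflip]
  intro x hx
  refine ⟨(hc.contDiff_convolution_right (lsmul ℝ ℝ) hg hρ).contDiffAt.of_le
    (by norm_cast), ?_⟩
  filter_upwards [isOpen_ball.mem_nhds hx] with y hy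
  rw [laplacian_convolution_right hg hρ hc]
  simp_rw [← laplacian_comp_const_sub hρ]
  have hts : Function.support (fun w => ρ (y - w)) ⊆ closedBall y δ := by
    intro w hw
    have := hsupp hw
    rw [mem_closedBall_zero_iff] at this
    rwa [mem_closedBall, dist_comm, dist_eq_norm]
  refine hΔ _ (hρ.comp (contDiff_const.sub contDiff_id)) ?_ ?_
  · exact HasCompactSupport.intro (isCompact_closedBall y δ)
      fun x hx => by_contra fun h => hx (hts h)
  · refine (closure_minimal hts isClosed_closedBall).trans fun w hw => ?_
    rw [mem_closedBall] at hw
    rw [mem_ball] at hy ⊢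
    linarith [dist_triangle w y z₀]

/-- The mean value property against a radial kernel. -/
theorem convolution_eq_of_radial {f : ℂ → ℝ} (hf : Continuous f) {ρ : ℝ → ℝ} {x : ℂ} {δ : ℝ}
    (hρ : Continuous fun z : ℂ => ρ ‖z‖)
    (hsupp : Function.support (fun z : ℂ => ρ ‖z‖) ⊆ closedBall 0 δ)
    (hh : HarmonicOnNhd f (closedBall x δ)) :
    ((fun z : ℂ => ρ ‖z‖) ⋆[lsmul ℝ ℝ, volume] f) x = (∫ z : ℂ, ρ ‖z‖) * f x := by
  -- Averaging over rotations leaves the integral unchanged, while for fixed `z` the average over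
  -- `θ` is a circle mean of `f`. Fubini compares the two without polar coordinates.
  have hrot : ∀ θ : ℝ, ∫ z : ℂ, ρ ‖z‖ * f (x + z * Complex.exp (θ * Complex.I)) =
      ∫ z : ℂ, ρ ‖z‖ * f (x + z) := by
    intro θ
    let e := rotation (Circle.exp θ)
    have := (e.measurePreserving).integral_comp e.toHomeomorph.measurableEmbedding
      (fun z => ρ ‖z‖ * f (x + z))
    rw [← this]
    congr 1
    ext z
    simp [e, rotation_apply, mul_comm]
  have hmean : ∀ z : ℂ, ∫ θ in (0)..(2 * Real.pi),
      ρ ‖z‖ * f (x + z * Complex.exp (θ * Complex.I)) = ρ ‖z‖ * (2 * Real.pi * f x) := by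
    intro z
    rw [intervalIntegral.integral_const_mul]
    by_cases hz : ρ ‖z‖ = 0
    · simp [hz]
    have hz' : ‖z‖ ≤ δ := mem_closedBall_zero_iff.1 (hsupp hz)
    have havg := (hh.mono (closedBall_subset_closedBall
      ((abs_of_nonneg (norm_nonneg z)).le.trans hz'))).circleAverage_eq
    have hper : Function.Periodic (fun θ : ℝ => f (circleMap x ‖z‖ θ)) (2 * Real.pi) :=
      fun θ => by simp only [periodic_circleMap x ‖z‖ θ]
    have hshift : ∫ θ in (0)..(2 * Real.pi), f (x + z * Complex.exp (θ * Complex.I)) =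
        ∫ θ in (0)..(2 * Real.pi), f (circleMap x ‖z‖ θ) := by
      have h1 : ∀ θ : ℝ, f (x + z * Complex.exp (θ * Complex.I)) =
          f (circleMap x ‖z‖ (θ + z.arg)) := by
        intro θ
        congr 1
        rw [circleMap, Complex.ofReal_add, add_mul, Complex.exp_add]
        nth_rewrite 1 [← Complex.norm_mul_exp_arg_mul_I z]
        ring
      simp_rw [h1]
      rw [intervalIntegral.integral_comp_add_right (fun θ => f (circleMap x ‖z‖ θ)),
        zero_add, add_comm (2 * Real.pi), hper.intervalIntegral_add_eq z.arg 0, zero_add]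
    rw [hshift, ← havg, Real.circleAverage_def, smul_eq_mul]
    field_simp
  have hint : Integrable (Function.uncurry fun (θ : ℝ) (z : ℂ) =>
      ρ ‖z‖ * f (x + z * Complex.exp (θ * Complex.I)))
      ((volume.restrict (Set.Ioc 0 (2 * Real.pi))).prod volume) := by
    have hcont : Continuous (Function.uncurry fun (θ : ℝ) (z : ℂ) =>
        ρ ‖z‖ * f (x + z * Complex.exp (θ * Complex.I))) :=
      (hρ.comp continuous_snd).mul (hf.comp (by fun_prop))
    have hK := (hcont.locallyIntegrable (μ := (volume : Measure (ℝ × ℂ)))).integrableOn_isCompact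
      ((isCompact_Icc (a := 0) (b := 2 * Real.pi)).prod (isCompact_closedBall (0 : ℂ) δ))
    rw [show (volume.restrict (Set.Ioc 0 (2 * Real.pi))).prod (volume : Measure ℂ) =
      (volume : Measure (ℝ × ℂ)).restrict (Set.Ioc 0 (2 * Real.pi) ×ˢ Set.univ) by
        rw [Measure.volume_eq_prod, ← Measure.prod_restrict, Measure.restrict_univ]]
    -- The integrand is continuous and vanishes for `z` outside the support disc, so integrability
    -- on a compact product suffices.
    refine hK.of_forall_sdiff_eq_zero (measurableSet_Ioc.prod MeasurableSet.univ) ?_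
    rintro ⟨θ, z⟩ ⟨⟨hθ, -⟩, hn⟩
    by_contra h0
    refine hn ⟨Set.Ioc_subset_Icc_self hθ, hsupp fun h => h0 ?_⟩
    simp only at h
    simp [Function.uncurry, h]
  have hswap := integral_integral_swap hint
  simp_rw [← intervalIntegral.integral_of_le Real.two_pi_pos.le, hmean, hrot] at hswap
  rw [intervalIntegral.integral_const, integral_mul_const, smul_eq_mul, sub_zero] at hswap
  -- The kernel is even, so `x - z` in the convolution may be replaced by `x + z`.
  have hneg := integral_neg_eq_self (fun z : ℂ => ρ ‖z‖ * f (x - z)) volume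
  simp only [norm_neg, sub_neg_eq_add] at hneg
  rw [convolution_lsmul]
  simp only [smul_eq_mul]
  rw [← hneg]
  have := Real.two_pi_pos
  apply mul_left_cancel₀ this.ne'
  rw [hswap]
  ring

/-- A smooth radial kernel supported in the disc of radius `δ`. -/
def radialKernel (δ : ℝ) (r : ℝ) : ℝ := Real.smoothTransition (1 - r ^ 2 / δ ^ 2)

theorem contDiff_radialKernel (δ : ℝ) : ContDiff ℝ ∞ fun z : ℂ => radialKernel δ ‖z‖ :=
  Real.smoothTransition.contDiff.comp (contDiff_const.sub ((contDiff_norm_sq ℝ).div_const _))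

theorem support_radialKernel {δ : ℝ} (hδ : 0 < δ) :
    Function.support (fun z : ℂ => radialKernel δ ‖z‖) ⊆ closedBall 0 δ := by
  intro z hz
  rw [mem_closedBall_zero_iff]
  by_contra! h
  refine hz (Real.smoothTransition.zero_of_nonpos ?_)
  rw [sub_nonpos, one_le_div (by positivity)]
  gcongr

theorem hasCompactSupport_radialKernel {δ : ℝ} (hδ : 0 < δ) :
    HasCompactSupport fun z : ℂ => radialKernel δ ‖z‖ :=
  HasCompactSupport.intro (isCompact_closedBall 0 δ)
    fun _ hx => by_contra fun h => hx (support_radialKernel hδ h)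

theorem integral_radialKernel_pos {δ : ℝ} (hδ : 0 < δ) : 0 < ∫ z : ℂ, radialKernel δ ‖z‖ := by
  refine (contDiff_radialKernel δ).continuous.integral_pos_of_hasCompactSupport_nonneg_nonzero
    (hasCompactSupport_radialKernel hδ) (fun z => Real.smoothTransition.nonneg _) (x := 0) ?_
  simp [radialKernel]

/-- Associativity reduces this to commutativity of `a ⋆ b`. It serves to exchange the fixed radial
kernel with an approximate identity. -/
theorem convolution_left_comm {a b g : ℂ → ℝ} (ha : Continuous a) (hac : HasCompactSupport a)
    (hb : Continuous b) (hbc : HasCompactSupport b) (hg : LocallyIntegrable g volume) :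
    a ⋆[lsmul ℝ ℝ, volume] (b ⋆[lsmul ℝ ℝ, volume] g) =
      b ⋆[lsmul ℝ ℝ, volume] (a ⋆[lsmul ℝ ℝ, volume] g) := by
  have key : ∀ {a b : ℂ → ℝ}, Continuous a → HasCompactSupport a → Continuous b →
      HasCompactSupport b → ∀ x, ((a ⋆[lsmul ℝ ℝ, volume] b) ⋆[lsmul ℝ ℝ, volume] g) x =
        (a ⋆[lsmul ℝ ℝ, volume] (b ⋆[lsmul ℝ ℝ, volume] g)) x := by
    intro a b ha hac hb hbc x
    refine convolution_assoc (lsmul ℝ ℝ) (lsmul ℝ ℝ) (lsmul ℝ ℝ) (lsmul ℝ ℝ)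
      (fun _ _ _ => by simp [mul_assoc]) ha.aestronglyMeasurable hb.aestronglyMeasurable
      hg.aestronglyMeasurable ?_ ?_ ?_
    · exact Eventually.of_forall fun y =>
        (hac.convolutionExists_left _ ha (hb.locallyIntegrable)) y
    · exact Eventually.of_forall fun y =>
        (hbc.norm.convolutionExists_left _ hb.norm (fun y => (hg y).norm)) y
    · exact hac.norm.convolutionExists_left _ ha.norm
        (hbc.norm.continuous_convolution_left _ hb.norm (fun y => (hg y).norm)).locallyIntegrable x
  ext x
  rw [← key ha hac hb hbc, ← key hb hbc ha hac]
  congr 1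
  rw [← convolution_flip]
  congr 1
  ext
  simp

/-- **Weyl's lemma** on a disc of the plane. -/
theorem exists_harmonic_ae_eq {g : ℂ → ℝ} {z₀ : ℂ} {r R : ℝ} (hrR : r < R)
    (hg : LocallyIntegrable g volume)
    (hΔ : ∀ φ : ℂ → ℝ, ContDiff ℝ ∞ φ → HasCompactSupport φ → tsupport φ ⊆ ball z₀ R →
      ∫ z, g z * Laplacian.laplacian φ z = 0) :
    ∃ f : ℂ → ℝ, HarmonicOnNhd f (ball z₀ r) ∧
      ∀ᵐ z ∂(volume : Measure ℂ), z ∈ ball z₀ r → g z = f z := by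
  -- Half the gap: one `δ` is spent on the radial kernel, the other bounds the radius of the
  -- approximate identity.
  set δ := (R - r) / 2 with hδ_def
  have hδ : 0 < δ := by rw [hδ_def]; linarith
  set ρ : ℂ → ℝ := fun z => radialKernel δ ‖z‖ with hρ_def
  have hρ : ContDiff ℝ ∞ ρ := contDiff_radialKernel δ
  have hρc : HasCompactSupport ρ := hasCompactSupport_radialKernel hδ
  set c := ∫ z : ℂ, radialKernel δ ‖z‖ with hc_def
  have hc : 0 < c := integral_radialKernel_pos hδ
  refine ⟨c⁻¹ • (ρ ⋆[lsmul ℝ ℝ, volume] g), ?_, ?_⟩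
  · refine HarmonicOnNhd.const_smul ?_
    exact (harmonicOnNhd_convolution hg hΔ hρ (support_radialKernel hδ)).mono
      (ball_subset_ball (by rw [hδ_def]; linarith))
  let φ : ℕ → ContDiffBump (0 : ℂ) := fun n =>
    ⟨δ / (n + 2) / 2, δ / (n + 2), by positivity, half_lt_self (by positivity)⟩
  have hφ : Tendsto (fun n => (φ n).rOut) atTop (𝓝 0) :=
    tendsto_const_nhds.div_atTop (tendsto_natCast_atTop_atTop.atTop_add tendsto_const_nhds)
  have hconv := ContDiffBump.ae_convolution_tendsto_right_of_locallyIntegrable (K := 2) hφ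
    (Eventually.of_forall fun n => by simp only [φ]; linarith) hg
  filter_upwards [hconv] with x hx hxr
  have hcont : Continuous (ρ ⋆[lsmul ℝ ℝ, volume] g) :=
    hρc.continuous_convolution_left _ hρ.continuous hg
  have hlim := ContDiffBump.convolution_tendsto_right_of_continuous (μ := volume) hφ hcont x
  -- The mollification `φₙ ⋆ g` is harmonic near `x`, so convolving it with `ρ` multiplies it by
  -- `c`. After exchanging the convolutions, `n → ∞` gives `(ρ ⋆ g) x = c * g x` at almost every
  -- `x`.
  have heq : ∀ n, ((φ n).normed volume ⋆[lsmul ℝ ℝ, volume]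
      (ρ ⋆[lsmul ℝ ℝ, volume] g)) x = c * ((φ n).normed volume ⋆[lsmul ℝ ℝ, volume] g) x := by
    intro n
    have hn : (φ n).rOut < δ := div_lt_self hδ (by have := Nat.cast_nonneg (α := ℝ) n; linarith)
    have hnc : HasCompactSupport ((φ n).normed volume) := (φ n).hasCompactSupport_normed
    have hns : Continuous ((φ n).normed volume) := (φ n).continuous_normed
    rw [← convolution_left_comm hρ.continuous hρc hns hnc hg]
    refine convolution_eq_of_radial (hnc.continuous_convolution_left _ hns hg) hρ.continuous
      (support_radialKernel hδ) ?_
    refine (harmonicOnNhd_convolution (δ := (φ n).rOut) hg hΔ (φ n).contDiff_normed ?_).mono ?_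
    · rw [(φ n).support_normed_eq]
      exact ball_subset_closedBall
    · intro w hw
      rw [mem_closedBall] at hw
      rw [mem_ball] at hxr ⊢
      have := dist_triangle w x z₀
      rw [hδ_def] at hw hn
      linarith
  simp_rw [heq] at hlim
  have := tendsto_nhds_unique hlim (hx.const_mul c)
  rw [Pi.smul_apply, this, smul_eq_mul, inv_mul_cancel_left₀ hc.ne']

end Pauli

/-! ### Calculus of the Wirtinger derivatives -/

namespace Pauli
open InnerProductSpace Metric

/-- The Wirtinger derivatives `(∂₁ + i s ∂₂)/2`: `∂` for `s = -1` and `∂̄` for `s = 1`. -/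
def wirtinger (s : ℝ) (f : ℂ → ℂ) (z : ℂ) : ℂ :=
  (fderiv ℝ f z 1 + s * (Complex.I * fderiv ℝ f z Complex.I)) / 2

theorem del_eq_wirtinger : del = wirtinger (-1) := by
  ext f z
  simp [del, wirtinger, sub_eq_add_neg]

theorem delBar_eq_wirtinger : delBar = wirtinger 1 := by
  ext f z
  simp [delBar, wirtinger]

theorem wirtinger_mul (s : ℝ) {f g : ℂ → ℂ} {z : ℂ} (hf : DifferentiableAt ℝ f z)
    (hg : DifferentiableAt ℝ g z) :
    wirtinger s (fun w => f w * g w) z = f z * wirtinger s g z + wirtinger s f z * g z := by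
  simp only [wirtinger, fderiv_fun_mul hf hg, add_apply, smul_apply,
    smul_eq_mul]
  ring

theorem wirtinger_add (s : ℝ) {f g : ℂ → ℂ} {z : ℂ} (hf : DifferentiableAt ℝ f z)
    (hg : DifferentiableAt ℝ g z) :
    wirtinger s (fun w => f w + g w) z = wirtinger s f z + wirtinger s g z := by
  simp only [wirtinger, fderiv_fun_add hf hg, add_apply]
  ring

theorem wirtinger_const (s : ℝ) (c z : ℂ) : wirtinger s (fun _ => c) z = 0 := by
  simp [wirtinger]

theorem wirtinger_conj (s : ℝ) (f : ℂ → ℂ) (z : ℂ) :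
    wirtinger s (fun w => conj (f w)) z = conj (wirtinger (-s) f z) := by
  have h : fderiv ℝ (fun w => conj (f w)) z =
      (Complex.conjCLE : ℂ →L[ℝ] ℂ).comp (fderiv ℝ f z) :=
    Complex.conjCLE.comp_fderiv (f := f)
  have h2 : conj (2 : ℂ) = 2 := Complex.conj_ofNat 2
  simp only [wirtinger, h]
  simp [h2]

theorem wirtinger_cexp (s : ℝ) {f : ℂ → ℂ} {z : ℂ} (hf : DifferentiableAt ℝ f z) :
    wirtinger s (fun w => Complex.exp (f w)) z = Complex.exp (f z) * wirtinger s f z := by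
  simp only [wirtinger, hf.hasFDerivAt.cexp.fderiv, smul_apply, smul_eq_mul]
  ring

theorem wirtinger_one_of_holomorphic {f : ℂ → ℂ} {z : ℂ} (hf : DifferentiableAt ℂ f z) :
    wirtinger 1 f z = 0 := by
  have h : ∀ v, fderiv ℝ f z v = v * deriv f z := fun v => by
    rw [hf.fderiv_restrictScalars ℝ, ContinuousLinearMap.coe_restrictScalars',
      ← fderiv_apply_one_eq_deriv, ← smul_eq_mul, ← map_smul, smul_eq_mul, mul_one]
  simp only [wirtinger, h]
  rw [← mul_assoc Complex.I, Complex.I_mul_I]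
  simp

theorem contDiff_wirtinger (s : ℝ) {f : ℂ → ℂ} (hf : ContDiff ℝ ∞ f) :
    ContDiff ℝ ∞ (wirtinger s f) := by
  have h : ∀ v, ContDiff ℝ ∞ fun z => fderiv ℝ f z v := fun v =>
    (hf.fderiv_right (m := ∞) (by simp)).clm_apply contDiff_const
  exact ((h 1).add (contDiff_const.mul (contDiff_const.mul (h Complex.I)))).div_const 2

theorem tsupport_wirtinger_subset (s : ℝ) (f : ℂ → ℂ) :
    tsupport (wirtinger s f) ⊆ tsupport f := by
  refine closure_minimal (fun z hz => ?_) (isClosed_tsupport f)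
  by_contra h
  refine hz ?_
  have h0 : fderiv ℝ f z = 0 := by
    by_contra h1
    exact h (support_fderiv_subset ℝ h1)
  simp [wirtinger, h0]

theorem hasCompactSupport_wirtinger (s : ℝ) {f : ℂ → ℂ} (hf : HasCompactSupport f) :
    HasCompactSupport (wirtinger s f) :=
  hf.of_isClosed_subset (isClosed_tsupport _) (tsupport_wirtinger_subset s f)

/-- Integration by parts for Wirtinger derivatives. -/
theorem integral_mul_wirtinger (s : ℝ) {f g : ℂ → ℂ} (hf : ContDiff ℝ ∞ f)
    (hfc : HasCompactSupport f) (hg : ContDiff ℝ ∞ g) :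
    ∫ z, f z * wirtinger s g z = -∫ z, wirtinger s f z * g z := by
  have hd : ∀ {f : ℂ → ℂ}, ContDiff ℝ ∞ f → ∀ v, Continuous fun z => fderiv ℝ f z v :=
    fun hf v => (hf.continuous_fderiv (by simp)).clm_apply continuous_const
  have hi1 : ∀ v, Integrable fun z => f z * fderiv ℝ g z v := fun v =>
    (hf.continuous.mul (hd hg v)).integrable_of_hasCompactSupport hfc.mul_right
  have hi2 : ∀ v, Integrable fun z => fderiv ℝ f z v * g z := fun v =>
    ((hd hf v).mul hg.continuous).integrable_of_hasCompactSupport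
      (hfc.fderiv_apply ℝ v).mul_right
  have key : ∀ v, ∫ z, f z * fderiv ℝ g z v = -∫ z, fderiv ℝ f z v * g z := fun v =>
    integral_mul_fderiv_eq_neg_fderiv_mul_of_integrable (hi2 v) (hi1 v)
      ((hf.continuous.mul hg.continuous).integrable_of_hasCompactSupport hfc.mul_right)
      (fun z _ => hf.differentiable (by simp) z) (fun z _ => hg.differentiable (by simp) z)
  have e1 : ∀ z, f z * wirtinger s g z = 2⁻¹ * (f z * fderiv ℝ g z 1) +
      (2⁻¹ * s * Complex.I) * (f z * fderiv ℝ g z Complex.I) := fun z => by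
    simp only [wirtinger]; ring
  have e2 : ∀ z, wirtinger s f z * g z = 2⁻¹ * (fderiv ℝ f z 1 * g z) +
      (2⁻¹ * s * Complex.I) * (fderiv ℝ f z Complex.I * g z) := fun z => by
    simp only [wirtinger]; ring
  simp_rw [e1, e2]
  rw [integral_add ((hi1 _).const_mul _) ((hi1 _).const_mul _),
    integral_add ((hi2 _).const_mul _) ((hi2 _).const_mul _)]
  simp_rw [integral_const_mul, key]
  ring

/-- Off `tsupport χ` the product vanishes locally, so the values of `a` outside `B` are irrelevant.
This lets the local gauge functions appear in globally defined test functions. -/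
theorem contDiff_mul_of_contDiffOn {a χ : ℂ → ℂ} {B : Set ℂ} (hB : IsOpen B)
    (ha : ContDiffOn ℝ ∞ a B) (hχ : ContDiff ℝ ∞ χ) (hs : tsupport χ ⊆ B) :
    ContDiff ℝ ∞ fun z => a z * χ z := by
  refine contDiff_iff_contDiffAt.2 fun z => ?_
  by_cases hz : z ∈ tsupport χ
  · exact (ha.contDiffAt (hB.mem_nhds (hs hz))).mul hχ.contDiffAt
  · refine (contDiffAt_const (c := (0 : ℂ))).congr_of_eventuallyEq ?_
    filter_upwards [notMem_tsupport_iff_eventuallyEq.1 hz] with w hw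
    simp [hw]

theorem weakDeriv_spec {d : (ℂ → ℂ) → ℂ → ℂ} {U : Set ℂ} {f : ℂ → ℂ}
    (h : ∃ g, HasWeakDeriv d U f g) : HasWeakDeriv d U f (weakDeriv d U f) := by
  rw [weakDeriv, dif_pos h]
  exact h.choose_spec

/-! ### The local gauge transform to the free Laplacian -/

section LocalGauge

variable {s : ℝ} {U B : Set ℂ} {Θ : ℂ → ℝ} {k χ : ℂ → ℂ}

/-- If `Θ = Re k` on `B` with `k` annihilated by the Wirtinger derivative, the weighted function
`e^Θ ψ` of `ψ = e^{i Im k} χ` is `e^k χ`, and differentiation only falls on `χ`. -/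
theorem hasWeakDeriv_weighted (hB : IsOpen B) (hk : ContDiffOn ℝ ∞ k B)
    (hk0 : ∀ z ∈ B, wirtinger s k z = 0)
    (hΘ : ∀ᵐ z ∂(volume : Measure ℂ), z ∈ B → Θ z = (k z).re)
    (hχ : ContDiff ℝ ∞ χ) (hχc : HasCompactSupport χ) (hχB : tsupport χ ⊆ B) {ψ : H}
    (hψ : ∀ᵐ z ∂(volume : Measure ℂ), ψ z = Complex.exp ((k z).im * Complex.I) * χ z) :
    HasWeakDeriv (wirtinger s) U (weighted Θ ψ)
      (fun z => Complex.exp (k z) * wirtinger s χ z) := by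
  have hv : ContDiff ℝ ∞ fun z => Complex.exp (k z) * χ z :=
    contDiff_mul_of_contDiffOn hB hk.cexp hχ hχB
  have hdv : ∀ z, wirtinger s (fun w => Complex.exp (k w) * χ w) z =
      Complex.exp (k z) * wirtinger s χ z := by
    intro z
    by_cases hz : z ∈ tsupport χ
    · have hkd : DifferentiableAt ℝ k z :=
        (hk.contDiffAt (hB.mem_nhds (hχB hz))).differentiableAt (by simp)
      rw [wirtinger_mul s hkd.cexp (hχ.differentiable (by simp) z), wirtinger_cexp s hkd,
        hk0 z (hχB hz)]
      ring
    · rw [image_eq_zero_of_notMem_tsupport fun h => hz (tsupport_wirtinger_subset s χ h),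
        image_eq_zero_of_notMem_tsupport (f := wirtinger s fun w => Complex.exp (k w) * χ w)
          fun h => hz (tsupport_mul_subset_right (tsupport_wirtinger_subset s _ h)), mul_zero]
  have hae : weighted Θ ψ =ᵐ[volume] fun z => Complex.exp (k z) * χ z := by
    filter_upwards [hΘ, hψ] with z hz hz'
    rw [weighted, hz']
    by_cases hzB : z ∈ B
    · rw [hz hzB, ← mul_assoc, Complex.ofReal_exp, ← Complex.exp_add, Complex.re_add_im]
    · rw [image_eq_zero_of_notMem_tsupport fun h => hzB (hχB h)]
      simp
  have hdw := contDiff_wirtinger s hv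
  simp_rw [← hdv]
  refine ⟨?_, hdw.continuous.locallyIntegrable.locallyIntegrableOn U, ?_⟩
  · exact (hv.continuous.locallyIntegrable.congr hae.symm).locallyIntegrableOn U
  · intro φ hφ _ _
    rw [← integral_mul_wirtinger s hv hχc.mul_left hφ]
    refine integral_congr_ae ?_
    filter_upwards [hae] with z hz
    rw [hz]

/-- The local gauge transform intertwines the operator of the form with the free Laplacian. -/
theorem mem_formOperator_of_localGauge (hU : IsOpen U) (hB : IsOpen B) (hBU : B ⊆ U)
    (hk : ContDiffOn ℝ ∞ k B)
    (hk0 : ∀ z ∈ B, wirtinger s k z = 0)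
    (hΘ : ∀ᵐ z ∂(volume : Measure ℂ), z ∈ B → Θ z = (k z).re)
    (hχ : ContDiff ℝ ∞ χ) (hχc : HasCompactSupport χ) (hχB : tsupport χ ⊆ B) {ψ η : H}
    (hψ : ∀ᵐ z ∂(volume : Measure ℂ), ψ z = Complex.exp ((k z).im * Complex.I) * χ z)
    (hη : ∀ᵐ z ∂(volume : Measure ℂ), η z = Complex.exp ((k z).im * Complex.I) *
      (-4 * wirtinger (-s) (wirtinger s χ) z)) :
    (ψ, η) ∈ formOperator (formDomain (wirtinger s) U Θ) (form (wirtinger s) U Θ) := by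
  have hw := hasWeakDeriv_weighted (U := U) hB hk hk0 hΘ hχ hχc hχB hψ
  have hw' := (weakDeriv_spec ⟨_, hw⟩).ae_eq hU hw
  have hdχ := contDiff_wirtinger s hχ
  have hdχc := hasCompactSupport_wirtinger s hχc
  have hdχB : tsupport (wirtinger s χ) ⊆ B := (tsupport_wirtinger_subset s χ).trans hχB
  have hzero : ∀ z, z ∉ B → wirtinger s χ z = 0 := fun z hz =>
    image_eq_zero_of_notMem_tsupport fun h => hz (hdχB h)
  refine ⟨⟨⟨_, hw⟩, ?_⟩, ?_⟩
  -- The factor `|e^k|² = e^{2 Re k}` cancels the weight `e^{-2Θ}`, leaving the integral of `|dχ|²`.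
  · have hint : Integrable fun z => ‖wirtinger s χ z‖ ^ 2 :=
      (hdχ.continuous.norm.pow 2).integrable_of_hasCompactSupport
        (hdχc.norm.mono fun z hz h => hz (by simp [h]))
    refine lt_of_le_of_lt (le_trans (lintegral_mono_ae ?_) (setLIntegral_le_lintegral U _))
      hint.lintegral_lt_top
    rw [ae_restrict_iff' hU.measurableSet]
    filter_upwards [hw', hΘ] with z hz hz' hzU
    refine ENNReal.ofReal_le_ofReal ?_
    rw [hz hzU]
    by_cases hzB : z ∈ B
    · rw [hz' hzB, norm_mul, Complex.norm_exp, mul_pow, ← Real.exp_nat_mul, mul_right_comm,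
        ← Real.exp_add]
      simp
    · simp [hzero z hzB]
  · intro φ hφ
    set g := weakDeriv (wirtinger s) U (weighted Θ φ) with hg_def
    have hg := weakDeriv_spec hφ.1
    have hconj : ContDiff ℝ ∞ fun z => conj (wirtinger s χ z) :=
      Complex.conjCLE.contDiff.comp hdχ
    have hts : tsupport (fun z => conj (wirtinger s χ z)) = tsupport (wirtinger s χ) := by
      simp [tsupport, Function.support]
    -- Chosen so that the form integrand equals `conj (g τ)`, because `e^k e^{-2 Re k} = e^{-conj
    -- k}`. As `τ` is a smooth test function supported in `B ⊆ U`, the weak derivative `g` of an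
    -- arbitrary form element can be integrated by parts against it.
    set τ : ℂ → ℂ := fun z => Complex.exp (-k z) * conj (wirtinger s χ z) with hτ_def
    have hτ : ContDiff ℝ ∞ τ :=
      contDiff_mul_of_contDiffOn hB hk.neg.cexp hconj (hts ▸ hdχB)
    have hτs : tsupport τ ⊆ tsupport (wirtinger s χ) :=
      hts ▸ tsupport_mul_subset_right
    have hτc : HasCompactSupport τ := hdχc.of_isClosed_subset (isClosed_tsupport _) hτs
    have hdτ : ∀ z, wirtinger s τ z =
        Complex.exp (-k z) * conj (wirtinger (-s) (wirtinger s χ) z) := by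
      intro z
      by_cases hz : z ∈ tsupport (wirtinger s χ)
      · have hkd : DifferentiableAt ℝ k z :=
          (hk.contDiffAt (hB.mem_nhds (hdχB hz))).differentiableAt (by simp)
        have hneg : wirtinger s (fun w => -k w) z = 0 := by
          have := hk0 z (hdχB hz)
          simp only [wirtinger, fderiv_fun_neg, neg_apply] at this ⊢
          linear_combination -this
        rw [hτ_def, wirtinger_mul s hkd.fun_neg.cexp (hconj.differentiable (by simp) z),
          wirtinger_cexp s hkd.fun_neg, wirtinger_conj, hneg]
        ring
      · rw [image_eq_zero_of_notMem_tsupport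
          (f := wirtinger (-s) (wirtinger s χ))
          fun h => hz (tsupport_wirtinger_subset (-s) _ h),
          image_eq_zero_of_notMem_tsupport (f := wirtinger s τ)
          fun h => hz (hτs (tsupport_wirtinger_subset s _ h))]
        simp
    have hform : ∫ z in U, conj (g z) * weakDeriv (wirtinger s) U (weighted Θ ψ) z *
        (Real.exp (-2 * Θ z) : ℂ) = ∫ z, conj (g z * τ z) := by
      rw [← setIntegral_eq_integral_of_forall_compl_eq_zero (s := U)
        (f := fun z => conj (g z * τ z))]
      · refine setIntegral_congr_ae hU.measurableSet ?_
        filter_upwards [hw', hΘ] with z hz hz' hzU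
        rw [hz hzU]
        by_cases hzB : z ∈ B
        · rw [hz' hzB]
          simp only [hτ_def, map_mul, Complex.conj_conj, ← Complex.exp_conj, map_neg]
          have : Complex.exp (k z) * Complex.ofReal (Real.exp (-2 * (k z).re)) =
              Complex.exp (-conj (k z)) := by
            rw [Complex.ofReal_exp, ← Complex.exp_add]
            congr 1
            apply Complex.ext <;> simp
            ring
          rw [← this]
          ring
        · simp [hτ_def, hzero z hzB]
      · intro z hz
        simp [hτ_def, hzero z fun h => hz (hBU h)]
    have hparts := hg.2.2 τ hτ hτc (hτs.trans (hdχB.trans hBU))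
    have hparts' : ∫ z, g z * τ z = -∫ z, weighted Θ φ z * wirtinger s τ z := by
      rw [hparts, neg_neg]
    rw [form, ← hg_def, hform, integral_conj, hparts', L2.inner_def,
      map_neg, ← integral_conj, mul_neg, ← neg_mul, ← integral_const_mul]
    refine integral_congr_ae ?_
    filter_upwards [hη, hΘ] with z hz hz'
    rw [hz, hdτ, RCLike.inner_apply]
    by_cases hzB : z ∈ B
    · rw [weighted, hz' hzB]
      simp only [map_mul, Complex.conj_conj, ← Complex.exp_conj, map_neg, Complex.conj_ofReal]
      have : Complex.ofReal (Real.exp (k z).re) * Complex.exp (-conj (k z)) =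
          Complex.exp ((k z).im * Complex.I) := by
        rw [Complex.ofReal_exp, ← Complex.exp_add]
        congr 1
        apply Complex.ext <;> simp
      rw [← this]
      ring
    · rw [image_eq_zero_of_notMem_tsupport (f := wirtinger (-s) (wirtinger s χ))
        fun h => hzB (hdχB (tsupport_wirtinger_subset (-s) _ h))]
      simp

end LocalGauge

end Pauli

/-! ### Cut-off plane waves as approximate eigenvectors -/

namespace Pauli
open InnerProductSpace Metric

/-- The plane wave `e^{iκx₁}`. -/
def planeWave (κ : ℝ) (z : ℂ) : ℂ := Complex.exp (κ * Complex.I * z.re)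

theorem contDiff_planeWave (κ : ℝ) : ContDiff ℝ ∞ (planeWave κ) :=
  (contDiff_const.mul (Complex.ofRealCLM.contDiff.comp Complex.reCLM.contDiff)).cexp

theorem norm_planeWave (κ : ℝ) (z : ℂ) : ‖planeWave κ z‖ = 1 := by
  simp [planeWave, Complex.norm_exp]

theorem wirtinger_planeWave (s κ : ℝ) (z : ℂ) :
    wirtinger s (planeWave κ) z = planeWave κ z * (κ * Complex.I / 2) := by
  have hl : HasFDerivAt (fun z : ℂ => (κ * Complex.I * z.re : ℂ))
      ((κ * Complex.I) • Complex.ofRealCLM.comp Complex.reCLM) z :=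
    (Complex.ofRealCLM.comp Complex.reCLM).hasFDerivAt.const_mul _
  have h := wirtinger_cexp s hl.differentiableAt
  rw [show planeWave κ = fun w => Complex.exp (κ * Complex.I * w.re) from rfl, h]
  simp [wirtinger, hl.fderiv]

theorem wirtinger_comp_dilation (s R : ℝ) (z₀ z : ℂ) {f : ℂ → ℂ} (hf : ContDiff ℝ ∞ f) :
    wirtinger s (fun w => f (R⁻¹ • (w - z₀))) z =
      (R : ℂ)⁻¹ * wirtinger s f (R⁻¹ • (z - z₀)) := by
  have hl : HasFDerivAt (fun w : ℂ => R⁻¹ • (w - z₀)) (R⁻¹ • ContinuousLinearMap.id ℝ ℂ) z :=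
    ((hasFDerivAt_id z).sub_const z₀).const_smul R⁻¹
  have h := ((hf.differentiable (by simp)) (R⁻¹ • (z - z₀))).hasFDerivAt.comp z hl
  rw [wirtinger, show (fun w => f (R⁻¹ • (w - z₀))) = f ∘ fun w => R⁻¹ • (w - z₀) from rfl,
    h.fderiv, wirtinger]
  simp only [ContinuousLinearMap.comp_apply, smul_apply, ContinuousLinearMap.id_apply]
  rw [map_smul, map_smul]
  generalize R⁻¹ • (z - z₀) = y
  rw [Complex.real_smul, Complex.real_smul, Complex.ofReal_inv]
  ring

theorem contDiff_comp_dilation (R : ℝ) (z₀ : ℂ) {f : ℂ → ℂ} (hf : ContDiff ℝ ∞ f) :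
    ContDiff ℝ ∞ fun w => f (R⁻¹ • (w - z₀)) :=
  hf.comp ((contDiff_id.sub contDiff_const).const_smul _)

theorem wirtinger_planeWave_mul (s κ R : ℝ) (z₀ z : ℂ) {f : ℂ → ℂ} (hf : ContDiff ℝ ∞ f) :
    wirtinger s (fun w => planeWave κ w * f (R⁻¹ • (w - z₀))) z =
      planeWave κ z * (κ * Complex.I / 2 * f (R⁻¹ • (z - z₀)) +
        (R : ℂ)⁻¹ * wirtinger s f (R⁻¹ • (z - z₀))) := by
  rw [wirtinger_mul s ((contDiff_planeWave κ).differentiable (by simp) z)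
    ((contDiff_comp_dilation R z₀ hf).differentiable (by simp) z), wirtinger_planeWave,
    wirtinger_comp_dilation s R z₀ z hf]
  ring

/-- Each derivative falling on the dilated cutoff costs a factor `R⁻¹`; the only term without such a
factor is the eigenvalue term `κ²`. -/
theorem wirtinger_wirtinger_planeWave_mul (s κ R : ℝ) (z₀ z : ℂ) {f : ℂ → ℂ}
    (hf : ContDiff ℝ ∞ f) :
    -4 * wirtinger (-s) (wirtinger s fun w => planeWave κ w * f (R⁻¹ • (w - z₀))) z =
      κ ^ 2 * (planeWave κ z * f (R⁻¹ • (z - z₀))) -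
      planeWave κ z * ((R : ℂ)⁻¹ * (2 * κ * Complex.I * (wirtinger s f (R⁻¹ • (z - z₀)) +
          wirtinger (-s) f (R⁻¹ • (z - z₀))) +
        (R : ℂ)⁻¹ * (4 * wirtinger (-s) (wirtinger s f) (R⁻¹ • (z - z₀))))) := by
  have hd := contDiff_wirtinger s hf
  have h1 : (wirtinger s fun w => planeWave κ w * f (R⁻¹ • (w - z₀))) = fun w =>
      planeWave κ w * (fun y => κ * Complex.I / 2 * f y + (R : ℂ)⁻¹ * wirtinger s f y)
        (R⁻¹ • (w - z₀)) := by
    ext w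
    rw [wirtinger_planeWave_mul s κ R z₀ w hf]
  have h2 : ∀ y, wirtinger (-s) (fun y => κ * Complex.I / 2 * f y +
      (R : ℂ)⁻¹ * wirtinger s f y) y = κ * Complex.I / 2 * wirtinger (-s) f y +
        (R : ℂ)⁻¹ * wirtinger (-s) (wirtinger s f) y := by
    intro y
    have hf' := hf.differentiable (by simp) y
    have hd' := hd.differentiable (by simp) y
    rw [wirtinger_add (-s) (hf'.const_mul _) (hd'.const_mul _),
      wirtinger_mul (-s) (differentiableAt_const _) hf',
      wirtinger_mul (-s) (differentiableAt_const _) hd', wirtinger_const, wirtinger_const]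
    ring
  rw [h1, wirtinger_planeWave_mul (-s) κ R z₀ z
    ((contDiff_const.mul hf).add (contDiff_const.mul hd)), h2]
  have hI : Complex.I ^ 2 = -1 := Complex.I_sq
  linear_combination (-planeWave κ z * κ ^ 2 * f (R⁻¹ • (z - z₀))) * hI

/-- A smooth cutoff equal to one on the unit disc and supported in the disc of radius two. -/
theorem exists_cutoff : ∃ η : ℂ → ℂ, ContDiff ℝ ∞ η ∧ tsupport η ⊆ closedBall 0 2 ∧
    ∀ z ∈ closedBall (0 : ℂ) 1, η z = 1 := by
  let b : ContDiffBump (0 : ℂ) := ⟨1, 2, one_pos, one_lt_two⟩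
  refine ⟨fun z => (b z : ℂ), Complex.ofRealCLM.contDiff.comp b.contDiff, ?_, fun z hz => ?_⟩
  · rw [show tsupport (fun z => (b z : ℂ)) = tsupport b by simp [tsupport, Function.support],
      b.tsupport_eq]
  · simp only [b.one_of_mem_closedBall hz, Complex.ofReal_one]

theorem norm_indicatorConstLp_closedBall (z₀ c : ℂ) {r : ℝ} (hr : 0 ≤ r) :
    ‖indicatorConstLp 2 (measurableSet_closedBall (x := z₀) (ε := r))
      (measure_closedBall_lt_top (μ := volume)).ne c‖ = ‖c‖ * (r * √Real.pi) := by
  rw [norm_indicatorConstLp (by simp) (by simp), Measure.real, Complex.volume_closedBall]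
  simp only [ENNReal.toReal_mul, ENNReal.toReal_pow, ENNReal.toReal_ofReal hr,
    ENNReal.coe_toReal, NNReal.coe_real_pi, ENNReal.toReal_ofNat]
  rw [← Real.sqrt_eq_rpow, Real.sqrt_mul (by positivity), Real.sqrt_sq hr]

/-- Cut-off plane waves, transported by the local gauge, are approximate eigenvectors. -/
theorem exists_approx_eigenpair (s κ : ℝ) : ∃ C : ℝ, ∀ (R : ℝ) (z₀ : ℂ) (U : Set ℂ) (Θ : ℂ → ℝ)
    (k : ℂ → ℂ), 1 ≤ R → IsOpen U → ball z₀ (3 * R) ⊆ U →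
    ContDiffOn ℝ ∞ k (ball z₀ (3 * R)) →
    (∀ z ∈ ball z₀ (3 * R), wirtinger s k z = 0) →
    (∀ᵐ z ∂(volume : Measure ℂ), z ∈ ball z₀ (3 * R) → Θ z = (k z).re) →
    ∃ q ∈ formOperator (formDomain (wirtinger s) U Θ) (form (wirtinger s) U Θ),
      (∀ᵐ z ∂(volume : Measure ℂ), z ∉ ball z₀ (3 * R) → q.1 z = 0 ∧ q.2 z = 0) ∧ q.1 ≠ 0 ∧
        ‖q.2 - ((κ ^ 2 : ℝ) : ℂ) • q.1‖ ≤ C / R * ‖q.1‖ := by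
  obtain ⟨η, hη, hηs, hη1⟩ := exists_cutoff
  have hηc : HasCompactSupport η :=
    (isCompact_closedBall 0 2).of_isClosed_subset (isClosed_tsupport _) hηs
  obtain ⟨C₁, hC₁⟩ := (contDiff_wirtinger s hη).continuous.bounded_above_of_compact_support
    (hasCompactSupport_wirtinger s hηc)
  obtain ⟨C₂, hC₂⟩ := (contDiff_wirtinger (-s) hη).continuous.bounded_above_of_compact_support
    (hasCompactSupport_wirtinger (-s) hηc)
  obtain ⟨C₃, hC₃⟩ := (contDiff_wirtinger (-s)
    (contDiff_wirtinger s hη)).continuous.bounded_above_of_compact_support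
    (hasCompactSupport_wirtinger (-s) (hasCompactSupport_wirtinger s hηc))
  set D := 2 * |κ| * (C₁ + C₂) + 4 * C₃ with hD
  have hC₁0 : 0 ≤ C₁ := (norm_nonneg _).trans (hC₁ 0)
  have hC₂0 : 0 ≤ C₂ := (norm_nonneg _).trans (hC₂ 0)
  have hC₃0 : 0 ≤ C₃ := (norm_nonneg _).trans (hC₃ 0)
  have hD0 : 0 ≤ D := by positivity
  -- The error is at most `D / R` pointwise on the disc of radius `2R`, while the vector has modulus
  -- one on the disc of radius `R`. The ratio of the radii gives the factor 2.
  refine ⟨2 * D, fun R z₀ U Θ k hR hU hBU hk hk0 hΘ => ?_⟩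
  have hR0 : 0 < R := one_pos.trans_le hR
  set χ : ℂ → ℂ := fun w => planeWave κ w * η (R⁻¹ • (w - z₀)) with hχ_def
  have hχ : ContDiff ℝ ∞ χ := (contDiff_planeWave κ).mul (contDiff_comp_dilation R z₀ hη)
  have hscale : ∀ z, z ∉ closedBall z₀ (2 * R) → R⁻¹ • (z - z₀) ∉ closedBall (0 : ℂ) 2 := by
    intro z hz h
    refine hz ?_
    rw [mem_closedBall_zero_iff, norm_smul, norm_inv, Real.norm_of_nonneg hR0.le,
      inv_mul_le_iff₀ hR0] at h
    rw [mem_closedBall, dist_eq_norm]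
    linarith
  have hχs : tsupport χ ⊆ closedBall z₀ (2 * R) := by
    refine closure_minimal (fun z hz => ?_) isClosed_closedBall
    by_contra h
    refine hz ?_
    simp only [hχ_def]
    rw [image_eq_zero_of_notMem_tsupport fun h' => hscale z h (hηs h'), mul_zero]
  have hχc : HasCompactSupport χ :=
    (isCompact_closedBall _ _).of_isClosed_subset (isClosed_tsupport _) hχs
  have hχB : tsupport χ ⊆ ball z₀ (3 * R) :=
    hχs.trans (closedBall_subset_ball (by linarith))
  set L : ℂ → ℂ := wirtinger (-s) (wirtinger s χ) with hL_def
  have hL : ContDiff ℝ ∞ L := contDiff_wirtinger _ (contDiff_wirtinger _ hχ)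
  have hLs : tsupport L ⊆ tsupport χ :=
    (tsupport_wirtinger_subset _ _).trans (tsupport_wirtinger_subset _ _)
  have hLc : HasCompactSupport L := hχc.of_isClosed_subset (isClosed_tsupport _) hLs
  set a : ℂ → ℂ := fun z => Complex.exp ((k z).im * Complex.I) with ha_def
  have ha : ContDiffOn ℝ ∞ a (ball z₀ (3 * R)) :=
    (((Complex.ofRealCLM.comp Complex.imCLM).contDiff.comp_contDiffOn hk).mul
      contDiffOn_const).cexp
  have ha1 : ∀ z, ‖a z‖ = 1 := fun z => Complex.norm_exp_ofReal_mul_I _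
  have hm₁ : MemLp (fun z => a z * χ z) 2 (volume : Measure ℂ) :=
    (contDiff_mul_of_contDiffOn isOpen_ball ha hχ hχB).continuous.memLp_of_hasCompactSupport
      hχc.mul_left
  have hm₂ : MemLp (fun z => a z * (-4 * L z)) 2 (volume : Measure ℂ) :=
    (contDiff_mul_of_contDiffOn isOpen_ball ha (contDiff_const.mul hL)
      (tsupport_mul_subset_right.trans (hLs.trans hχB))).continuous.memLp_of_hasCompactSupport
      hLc.mul_left.mul_left
  have hq₁ := hm₁.coeFn_toLp
  have hq₂ := hm₂.coeFn_toLp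
  have hlow : R * √Real.pi ≤ ‖hm₁.toLp‖ := by
    have h := norm_indicatorConstLp_closedBall z₀ 1 hR0.le
    rw [norm_one, one_mul] at h
    rw [← h]
    refine Lp.norm_le_norm_of_ae_le ?_
    filter_upwards [hq₁, indicatorConstLp_coeFn (p := 2) (μ := volume)
      (hs := measurableSet_closedBall (x := z₀) (ε := R))
      (hμs := measure_closedBall_lt_top.ne) (c := (1 : ℂ))] with z h1 h2
    rw [h1, h2]
    by_cases hz : z ∈ closedBall z₀ R
    · have hy : R⁻¹ • (z - z₀) ∈ closedBall (0 : ℂ) 1 := by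
        rw [mem_closedBall, dist_eq_norm] at hz
        rw [mem_closedBall_zero_iff, norm_smul, norm_inv, Real.norm_of_nonneg hR0.le,
          inv_mul_le_iff₀ hR0]
        linarith
      rw [Set.indicator_of_mem hz, norm_mul, ha1, hχ_def, norm_mul, norm_planeWave, hη1 _ hy]
      simp
    · rw [Set.indicator_of_notMem hz, norm_zero]
      exact norm_nonneg _
  have hup : ‖hm₂.toLp - ((κ ^ 2 : ℝ) : ℂ) • hm₁.toLp‖ ≤ D / R * (2 * R * √Real.pi) := by
    have h := norm_indicatorConstLp_closedBall z₀ ((D / R : ℝ) : ℂ) (r := 2 * R) (by positivity)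
    rw [Complex.norm_real, Real.norm_of_nonneg (by positivity)] at h
    rw [← h]
    refine Lp.norm_le_norm_of_ae_le ?_
    filter_upwards [hq₁, hq₂, Lp.coeFn_sub hm₂.toLp (((κ ^ 2 : ℝ) : ℂ) • hm₁.toLp),
      Lp.coeFn_smul ((κ ^ 2 : ℝ) : ℂ) hm₁.toLp, indicatorConstLp_coeFn (p := 2) (μ := volume)
      (hs := measurableSet_closedBall (x := z₀) (ε := 2 * R))
      (hμs := measure_closedBall_lt_top.ne) (c := ((D / R : ℝ) : ℂ))] with z h1 h2 h3 h4 h5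
    rw [h3, Pi.sub_apply, h4, Pi.smul_apply, h1, h2, h5]
    by_cases hz : z ∈ closedBall z₀ (2 * R)
    · rw [Set.indicator_of_mem hz, Complex.norm_real, Real.norm_of_nonneg (by positivity),
        hL_def, wirtinger_wirtinger_planeWave_mul s κ R z₀ z hη]
      set y := R⁻¹ • (z - z₀)
      have : a z * (κ ^ 2 * (planeWave κ z * η y) - planeWave κ z * ((R : ℂ)⁻¹ *
          (2 * κ * Complex.I * (wirtinger s η y + wirtinger (-s) η y) +
          (R : ℂ)⁻¹ * (4 * wirtinger (-s) (wirtinger s η) y)))) -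
          ((κ ^ 2 : ℝ) : ℂ) • (a z * χ z) = -(a z * planeWave κ z * ((R : ℂ)⁻¹ *
          (2 * κ * Complex.I * (wirtinger s η y + wirtinger (-s) η y) +
          (R : ℂ)⁻¹ * (4 * wirtinger (-s) (wirtinger s η) y)))) := by
        simp only [hχ_def, smul_eq_mul, Complex.ofReal_pow]
        ring
      rw [this, norm_neg, norm_mul, norm_mul, ha1, norm_planeWave, one_mul, one_mul, norm_mul,
        norm_inv, Complex.norm_real, Real.norm_of_nonneg hR0.le, div_eq_inv_mul]
      refine mul_le_mul_of_nonneg_left ?_ (by positivity)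
      refine (norm_add_le _ _).trans (add_le_add ?_ ?_)
      · rw [norm_mul]
        simp only [norm_mul, Complex.norm_ofNat, Complex.norm_real, Real.norm_eq_abs,
          Complex.norm_I, mul_one]
        gcongr
        exact (norm_add_le _ _).trans (add_le_add (hC₁ y) (hC₂ y))
      · rw [norm_mul, norm_mul, norm_inv, Complex.norm_real, Real.norm_of_nonneg hR0.le,
          Complex.norm_ofNat]
        -- Here `1 ≤ R` absorbs the second-order term, of size `R⁻²`, into the bound `D / R`.
        refine (mul_le_of_le_one_left (by positivity) (inv_le_one_of_one_le₀ hR)).trans ?_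
        gcongr
        exact hC₃ y
    · rw [image_eq_zero_of_notMem_tsupport fun h' => hz (hχs h'),
        image_eq_zero_of_notMem_tsupport (f := L) fun h' => hz (hχs (hLs h'))]
      simp
  refine ⟨(hm₁.toLp, hm₂.toLp), mem_formOperator_of_localGauge hU isOpen_ball hBU hk hk0 hΘ hχ hχc
    hχB hq₁ hq₂, ?_, ?_, hup.trans ?_⟩
  · filter_upwards [hq₁, hq₂] with z h1 h2 hz
    rw [h1, h2, image_eq_zero_of_notMem_tsupport fun h' => hz (hχB h'),
      image_eq_zero_of_notMem_tsupport (f := L) fun h' => hz (hχB (hLs h'))]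
    simp
  · intro h0
    simp only at h0
    rw [h0, norm_zero] at hlow
    have : 0 < R * √Real.pi := mul_pos hR0 (Real.sqrt_pos.2 Real.pi_pos)
    linarith
  · calc D / R * (2 * R * √Real.pi) = 2 * D / R * (R * √Real.pi) := by ring
      _ ≤ _ := by gcongr

/-- A harmonic function on a disc is the real part of a smooth function annihilated by the
Wirtinger derivative. -/
theorem exists_wirtinger_primitive {s : ℝ} (hs : s = 1 ∨ s = -1) {f : ℂ → ℝ} {z₀ : ℂ} {R : ℝ}
    (hf : HarmonicOnNhd f (ball z₀ R)) : ∃ k : ℂ → ℂ, ContDiffOn ℝ ∞ k (ball z₀ R) ∧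
      (∀ z ∈ ball z₀ R, wirtinger s k z = 0) ∧ ∀ z ∈ ball z₀ R, f z = (k z).re := by
  obtain ⟨h, hh, hre⟩ := hf.exists_analyticOnNhd_ball_re_eq
  have hsm : ContDiffOn ℝ ∞ h (ball z₀ R) := fun z hz =>
    ((hh z hz).contDiffAt.restrict_scalars ℝ).contDiffWithinAt
  rcases hs with rfl | rfl
  · exact ⟨h, hsm, fun z hz => wirtinger_one_of_holomorphic (hh z hz).differentiableAt,
      fun z hz => (hre hz).symm⟩
  · refine ⟨fun z => conj (h z), Complex.conjCLE.contDiff.comp_contDiffOn hsm, fun z hz => ?_,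
      fun z hz => ?_⟩
    · rw [wirtinger_conj, neg_neg, wirtinger_one_of_holomorphic (hh z hz).differentiableAt,
        map_zero]
    · rw [Complex.conj_re]
      exact (hre hz).symm

/-- `V` contains arbitrarily large discs on which `Θ` is almost everywhere harmonic. -/
def HarmonicOnLargeDiscs (V : Set ℂ) (Θ : ℂ → ℝ) : Prop :=
  ∀ R : ℝ, 0 < R → ∃ z₀ : ℂ, ball z₀ R ⊆ V ∧ ∃ f : ℂ → ℝ,
    HarmonicOnNhd f (ball z₀ R) ∧ ∀ᵐ z ∂(volume : Measure ℂ), z ∈ ball z₀ R → Θ z = f z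

theorem HarmonicOnLargeDiscs.neg {V : Set ℂ} {Θ : ℂ → ℝ} (hΘ : HarmonicOnLargeDiscs V Θ) :
    HarmonicOnLargeDiscs V fun z => -Θ z := by
  intro R hR
  obtain ⟨z₀, hV, f, hf, hae⟩ := hΘ R hR
  exact ⟨z₀, hV, -f, hf.neg, hae.mono fun z h hz => by simp [h hz]⟩

/-- If the potential is harmonic on arbitrarily large discs contained in `V`, there are
approximate eigenvectors supported in `V` for every nonnegative spectral parameter. -/
theorem exists_approx_of_harmonic {s : ℝ} (hs : s = 1 ∨ s = -1) {U V : Set ℂ} (hU : IsOpen U)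
    (hVU : V ⊆ U) {Θ : ℂ → ℝ}
    (hΘ : HarmonicOnLargeDiscs V Θ)
    (κ : ℝ) {ε : ℝ} (hε : 0 < ε) :
    ∃ q ∈ formOperator (formDomain (wirtinger s) U Θ) (form (wirtinger s) U Θ),
      (∀ᵐ z ∂(volume : Measure ℂ), z ∉ V → q.1 z = 0 ∧ q.2 z = 0) ∧ q.1 ≠ 0 ∧
        ‖q.2 - ((κ ^ 2 : ℝ) : ℂ) • q.1‖ ≤ ε * ‖q.1‖ := by
  obtain ⟨C, hC⟩ := exists_approx_eigenpair s κ
  -- Large enough that `C / R ≤ ε`; the disc of radius `3R` leaves room for the cutoff, supported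
  -- within radius `2R`.
  set R := max 1 (C / ε)
  have hR : 1 ≤ R := le_max_left _ _
  obtain ⟨z₀, hV, f, hf, hae⟩ := hΘ (3 * R) (by linarith)
  obtain ⟨k, hk, hk0, hfk⟩ := exists_wirtinger_primitive hs hf
  obtain ⟨q, hq, hq0, hne, hle⟩ := hC R z₀ U Θ k hR hU (hV.trans hVU) hk hk0
    (hae.mono fun z h hz => (h hz).trans (hfk z hz))
  refine ⟨q, hq, hq0.mono fun z h hz => h fun h' => hz (hV h'), hne, hle.trans ?_⟩
  gcongr
  rw [div_le_iff₀ (by linarith), mul_comm, ← div_le_iff₀ hε]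
  exact le_max_right _ _

/-! ### From approximate eigenvectors to the spectrum, and gauge conjugation -/

/-- A bounded inverse `T` of `S - lam` would give `‖q.1‖ ≤ ‖T‖ ε ‖q.1‖`, impossible once `‖T‖ ε <
1`. Only this direction of Weyl's criterion is used, so it holds for any graph `S`. -/
theorem mem_spec_of_approx {S : Set (H × H)} {lam : ℂ}
    (h : ∀ ε : ℝ, 0 < ε → ∃ q ∈ S, q.1 ≠ 0 ∧ ‖q.2 - lam • q.1‖ ≤ ε * ‖q.1‖) : lam ∈ spec S := by
  rintro ⟨T, hT⟩
  obtain ⟨q, hq, hne, hle⟩ := h (‖T‖ + 1)⁻¹ (by positivity)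
  have heq : q.1 = T (q.2 - lam • q.1) := (hT _ _).1 (by simpa using hq)
  have hpos : 0 < ‖q.1‖ := norm_pos_iff.2 hne
  have h1 : ‖q.1‖ ≤ ‖T‖ * ((‖T‖ + 1)⁻¹ * ‖q.1‖) := by
    conv_lhs => rw [heq]
    exact (T.le_opNorm _).trans (by gcongr)
  have h2 : ‖T‖ * ((‖T‖ + 1)⁻¹ * ‖q.1‖) < ‖q.1‖ := by
    rw [← mul_assoc]
    refine mul_lt_of_lt_one_left hpos ?_
    rw [← div_eq_mul_inv, div_lt_one (by positivity)]
    linarith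
  linarith

theorem zeroNotIsolated_of_approx {S : Set (H × H)}
    (h : ∀ κ ε : ℝ, 0 < ε → ∃ q ∈ S, q.1 ≠ 0 ∧
      ‖q.2 - ((κ ^ 2 : ℝ) : ℂ) • q.1‖ ≤ ε * ‖q.1‖) : ZeroNotIsolated S := by
  have hs : ∀ κ : ℝ, ((κ ^ 2 : ℝ) : ℂ) ∈ spec S := fun κ => mem_spec_of_approx (h κ)
  refine ⟨by simpa using hs 0, fun ε hε => ⟨_, hs √(ε / 2), ?_, ?_⟩⟩
  · rw [Real.sq_sqrt (by positivity)]
    exact_mod_cast (half_pos hε).ne'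
  · rw [Real.sq_sqrt (by positivity), Complex.norm_real, Real.norm_of_nonneg (by positivity)]
    exact half_lt_self hε

/-- Approximate eigenvectors supported where the gauge factor is unimodular survive
conjugation. -/
theorem exists_approx_gaugeConj {S : Set (H × H)} {W : ℂ → ℂ} {V : Set ℂ} {lam : ℂ} {ε : ℝ}
    (hW : Measurable W) (hle : ∀ z, ‖W z‖ ≤ 1) (hV : ∀ z ∈ V, ‖W z‖ = 1) {q : H × H} (hq : q ∈ S)
    (hq0 : ∀ᵐ z ∂(volume : Measure ℂ), z ∉ V → q.1 z = 0 ∧ q.2 z = 0) (hne : q.1 ≠ 0)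
    (hε : ‖q.2 - lam • q.1‖ ≤ ε * ‖q.1‖) :
    ∃ p ∈ gaugeConj W S, p.1 ≠ 0 ∧ ‖p.2 - lam • p.1‖ ≤ ε * ‖p.1‖ := by
  have hWm : Measurable fun z => conj (W z) := Complex.continuous_conj.measurable.comp hW
  have hm : ∀ f : H, MemLp (fun z => conj (W z) * f z) 2 (volume : Measure ℂ) := fun f => by
    refine (Lp.memLp f).of_le (hWm.aestronglyMeasurable.mul (Lp.aestronglyMeasurable f)) ?_
    refine Eventually.of_forall fun z => ?_
    rw [norm_mul, RCLike.norm_conj]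
    exact mul_le_of_le_one_left (norm_nonneg _) (hle z)
  -- Multiplication by `conj W` inverts `W` on `V`, and the vectors vanish almost everywhere off
  -- `V`; nothing more than `‖W‖ ≤ 1` is needed there.
  have hunit : ∀ z ∈ V, W z * conj (W z) = 1 := fun z hz => by
    rw [Complex.mul_conj, Complex.normSq_eq_norm_sq, hV z hz]
    simp
  have hback : ∀ f : H, (∀ᵐ z ∂(volume : Measure ℂ), z ∉ V → f z = 0) →
      ∀ᵐ z ∂(volume : Measure ℂ), f z = W z * ((hm f).toLp : H) z := fun f hf => by
    filter_upwards [hf, (hm f).coeFn_toLp] with z h1 h2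
    rw [h2]
    by_cases hz : z ∈ V
    · rw [← mul_assoc, hunit z hz, one_mul]
    · simp [h1 hz]
  have h1 := hback q.1 (hq0.mono fun z h hz => (h hz).1)
  have h2 := hback q.2 (hq0.mono fun z h hz => (h hz).2)
  have hn1 : ‖q.1‖ ≤ ‖(hm q.1).toLp‖ := by
    refine Lp.norm_le_norm_of_ae_le ?_
    filter_upwards [h1] with z hz
    rw [hz, norm_mul]
    exact mul_le_of_le_one_left (norm_nonneg _) (hle z)
  have hn1' : ‖(hm q.1).toLp‖ ≤ ‖q.1‖ := by
    refine Lp.norm_le_norm_of_ae_le ?_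
    filter_upwards [(hm q.1).coeFn_toLp] with z hz
    rw [hz, norm_mul, RCLike.norm_conj]
    exact mul_le_of_le_one_left (norm_nonneg _) (hle z)
  have hn2 : ‖(hm q.2).toLp - lam • (hm q.1).toLp‖ ≤ ‖q.2 - lam • q.1‖ := by
    refine Lp.norm_le_norm_of_ae_le ?_
    filter_upwards [(hm q.1).coeFn_toLp, (hm q.2).coeFn_toLp,
      Lp.coeFn_sub (hm q.2).toLp (lam • (hm q.1).toLp), Lp.coeFn_smul lam (hm q.1).toLp,
      Lp.coeFn_sub q.2 (lam • q.1), Lp.coeFn_smul lam q.1] with z e1 e2 e3 e4 e5 e6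
    rw [e3, e5, Pi.sub_apply, Pi.sub_apply, e4, e6, Pi.smul_apply, Pi.smul_apply, e1, e2,
      smul_eq_mul, smul_eq_mul, mul_left_comm, ← mul_sub, norm_mul, RCLike.norm_conj]
    exact mul_le_of_le_one_left (norm_nonneg _) (hle z)
  refine ⟨((hm q.1).toLp, (hm q.2).toLp), ⟨q, hq, h1, h2⟩, ?_, ?_⟩
  · rw [← norm_pos_iff]
    exact (norm_pos_iff.2 hne).trans_le hn1
  · rw [show ‖(hm q.1).toLp‖ = ‖q.1‖ from le_antisymm hn1' hn1]
    exact hn2.trans hε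

/-! ### Harmonicity of the potentials on field-free discs -/

namespace MagneticField

/-- A cluster point outside the set would be an accumulation point. Closedness makes the domain of
the maximal forms open. -/
theorem isClosed_atoms (μ : MagneticField) : IsClosed μ.atoms := by
  rw [isClosed_iff_clusterPt]
  intro z hz
  by_contra h
  refine μ.noAccPt_atoms z ?_
  rw [accPt_principal_iff_clusterPt]
  rwa [show {w : ℂ | μ.pos {w} ≠ 0 ∨ μ.neg {w} ≠ 0} \ {z} = μ.atoms from
    Set.sdiff_singleton_eq_self h]

theorem VanishesOn.subset_compl_atoms {μ : MagneticField} {s : Set ℂ} (h : μ.VanishesOn s) :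
    s ⊆ μ.atomsᶜ := by
  rintro z hz (h' | h')
  · exact h' (measure_mono_null (Set.singleton_subset_iff.2 hz) h.1)
  · exact h' (measure_mono_null (Set.singleton_subset_iff.2 hz) h.2)

theorem reducingInt_eq_zero {μ : MagneticField} {z : ℂ} (hz : z ∉ μ.atoms) :
    μ.reducingInt z = 0 := by
  simp only [atoms, Set.mem_ofPred_eq, not_or, not_not] at hz
  rw [reducingInt, intensity, hz.1, hz.2]
  norm_num

/-- A potential is almost everywhere harmonic inside a disc without field. -/
theorem IsPotential.exists_harmonic {μ : MagneticField} {Ψ : ℂ → ℝ} (hΨ : μ.IsPotential Ψ)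
    {z₀ : ℂ} {r R : ℝ} (hrR : r < R) (h : μ.VanishesOn (ball z₀ R)) :
    ∃ f : ℂ → ℝ, HarmonicOnNhd f (ball z₀ r) ∧
      ∀ᵐ z ∂(volume : Measure ℂ), z ∈ ball z₀ r → Ψ z = f z := by
  refine exists_harmonic_ae_eq hrR hΨ.1 fun φ hφ hc hs => ?_
  have hzero : ∀ ν : Measure ℂ, ν (ball z₀ R) = 0 → ∫ z, φ z ∂ν = 0 := fun ν hν => by
    refine integral_eq_zero_of_ae ?_
    filter_upwards [measure_eq_zero_iff_ae_notMem.1 hν] with z hz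
    exact image_eq_zero_of_notMem_tsupport fun h' => hz (hs h')
  rw [hΨ.2 φ hφ hc, hzero _ h.1, hzero _ h.2, sub_zero]

end MagneticField

theorem IsGauge.ne_zero {μ : MagneticField} {F G : ℂ → ℂ} (h : IsGauge μ F G) {z : ℂ}
    (hz : z ∉ μ.atoms) : F z ≠ 0 ∧ G z ≠ 0 := by
  have hF := h.order_F z
  have hG := h.order_G z
  rw [MagneticField.reducingInt_eq_zero hz] at hF hG
  exact ⟨((h.entire_F.analyticAt z).analyticOrderAt_eq_zero).1 (by simpa using hF),
    ((h.entire_G.analyticAt z).analyticOrderAt_eq_zero).1 (by simpa using hG)⟩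

theorem measurable_gaugeFactor {F G : ℂ → ℂ} (hF : Continuous F) (hG : Continuous G) :
    Measurable (gaugeFactor F G) := by
  have h : Continuous fun z => F z * conj (G z) := hF.mul (Complex.continuous_conj.comp hG)
  exact (Complex.continuous_conj.comp h).measurable.div
    (Complex.continuous_ofReal.comp h.norm).measurable

theorem norm_gaugeFactor (F G : ℂ → ℂ) (z : ℂ) :
    ‖gaugeFactor F G z‖ = ‖F z * conj (G z)‖ / ‖F z * conj (G z)‖ := by
  rw [gaugeFactor, norm_div, RCLike.norm_conj, Complex.norm_real, norm_norm]

theorem harmonicOnLargeDiscs_potential {μ : MagneticField}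
    (hμ : ∀ R : ℝ, 0 < R → ∃ z₀ : ℂ, μ.VanishesOn (ball z₀ R)) {Ψ : ℂ → ℝ}
    (hΨ : μ.IsPotential Ψ) : HarmonicOnLargeDiscs μ.atomsᶜ Ψ := by
  intro R hR
  -- Weyl's lemma is available only on a strictly smaller disc, hence the extra unit of radius.
  obtain ⟨z₀, hz₀⟩ := hμ (R + 1) (by linarith)
  exact ⟨z₀, (ball_subset_ball (by linarith)).trans hz₀.subset_compl_atoms,
    hΨ.exists_harmonic (by linarith) hz₀⟩

/-- Off the atoms the reducing integer is zero, so `F` and `G` have no zeros there and the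
logarithms of their moduli are harmonic. -/
theorem HarmonicOnLargeDiscs.reducedPotential {μ : MagneticField} {Ψ : ℂ → ℝ} {F G : ℂ → ℂ}
    (hΨ : HarmonicOnLargeDiscs μ.atomsᶜ Ψ) (h : IsGauge μ F G) :
    HarmonicOnLargeDiscs μ.atomsᶜ (reducedPotential Ψ F G) := by
  intro R hR
  obtain ⟨z₀, hV, f, hf, hae⟩ := hΨ R hR
  refine ⟨z₀, hV, f + (fun z => Real.log ‖F z‖) - fun z => Real.log ‖G z‖,
    fun z hz => ((hf z hz).add ?_).sub ?_, ?_⟩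
  · exact (h.entire_F.analyticAt z).harmonicAt_log_norm (h.ne_zero (hV hz)).1
  · exact (h.entire_G.analyticAt z).harmonicAt_log_norm (h.ne_zero (hV hz)).2
  · filter_upwards [hae] with z hz hzB
    simp [Pauli.reducedPotential, hz hzB]

theorem zeroNotIsolated_formOperator {s : ℝ} (hs : s = 1 ∨ s = -1) {U : Set ℂ} (hU : IsOpen U)
    {Θ : ℂ → ℝ} (hΘ : HarmonicOnLargeDiscs U Θ) :
    ZeroNotIsolated (formOperator (formDomain (wirtinger s) U Θ) (form (wirtinger s) U Θ)) :=
  zeroNotIsolated_of_approx fun κ _ hε =>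
    have ⟨q, hq, _, hne, hle⟩ := exists_approx_of_harmonic hs hU subset_rfl hΘ κ hε
    ⟨q, hq, hne, hle⟩

theorem zeroNotIsolated_gaugeConj {s : ℝ} (hs : s = 1 ∨ s = -1) {μ : MagneticField}
    {F G : ℂ → ℂ} (h : IsGauge μ F G) {Θ : ℂ → ℝ} (hΘ : HarmonicOnLargeDiscs μ.atomsᶜ Θ) :
    ZeroNotIsolated (gaugeConj (gaugeFactor F G)
      (formOperator (formDomain (wirtinger s) Set.univ Θ) (form (wirtinger s) Set.univ Θ))) := by
  refine zeroNotIsolated_of_approx fun κ ε hε => ?_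
  -- The form lives on the whole plane, but the approximate eigenvectors are kept off the atoms,
  -- where the gauge factor has modulus one.
  obtain ⟨q, hq, hq0, hne, hle⟩ :=
    exists_approx_of_harmonic hs isOpen_univ (Set.subset_univ _) hΘ κ hε
  refine exists_approx_gaugeConj
    (measurable_gaugeFactor h.entire_F.continuous h.entire_G.continuous) (fun z => ?_)
    (fun z hz => ?_) hq hq0 hne hle
  -- At zeros of `F` or `G` the quotient is `0 / 0 = 0`, so globally only the bound by one holds.
  · rw [norm_gaugeFactor]
    exact div_self_le_one _
  · rw [norm_gaugeFactor, div_self]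
    simpa using h.ne_zero hz

end Pauli

end

theorem mainTheorem7 (μ : Pauli.MagneticField)
    (hμ : ∀ R : ℝ, 0 < R → ∃ z₀ : ℂ, μ.VanishesOn (Metric.ball z₀ R))
    (Ψ : ℂ → ℝ) (hΨ : μ.IsPotential Ψ) :
    (Pauli.ZeroNotIsolated (Pauli.minusMax μ Ψ) ∧ Pauli.ZeroNotIsolated (Pauli.plusMax μ Ψ)) ∧
    ∀ F G : ℂ → ℂ, Pauli.IsGauge μ F G →
      Pauli.ZeroNotIsolated (Pauli.minusEV Ψ F G) ∧
        Pauli.ZeroNotIsolated (Pauli.plusEV Ψ F G) := by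
  have hd := Pauli.harmonicOnLargeDiscs_potential hμ hΨ
  have hU : IsOpen μ.atomsᶜ := μ.isClosed_atoms.isOpen_compl
  unfold Pauli.minusMax Pauli.plusMax Pauli.minusEV Pauli.plusEV Pauli.minusOperator
    Pauli.plusOperator
  rw [Pauli.del_eq_wirtinger, Pauli.delBar_eq_wirtinger]
  refine ⟨⟨Pauli.zeroNotIsolated_formOperator (.inr rfl) hU hd,
    Pauli.zeroNotIsolated_formOperator (.inl rfl) hU hd.neg⟩, fun F G h => ?_⟩
  have hr := hd.reducedPotential h
  exact ⟨Pauli.zeroNotIsolated_gaugeConj (.inr rfl) h hr,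
    Pauli.zeroNotIsolated_gaugeConj (.inl rfl) h hr.neg⟩
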